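/- Let $(\Omega,\mathcal F,\mathbb P)$ be a probability space and, for every $n\ge 1$, let $\mathcal C_n\subseteq\mathcal F$ be a sub-$\sigma$-field. Let $e_{1,n},\dots,e_{n,n}$ be random vectors in $\mathbb R^{d}$ that are conditionally independent given $\mathcal C_n$. For each $i\le n$ let $e^*_{i,n}$ be a random vector in $\mathbb R^d$ that has the same conditional distribution given $\mathcal C_n$ as $e_{i,n}$ and is such that $e^*_{i,n},e_{1,n},\dots,e_{n,n}$ are conditionally independent given $\mathcal C_n$. For measurable functions $F_{j,n}:(\mathbb R^d)^n\to\mathbb R$, $1\le j\le n$, put $$Y_{j,n}=F_{j,n}(e_{1,n},\dots,e_{n,n}),\qquad Y_{j,n,i}=F_{j,n}(e_{1,n},\dots,e_{i-1,n},e^*_{i,n},e_{i+1,n},\dots,e_{n,n}),$$ and assume that $\mathbb E(|Y_{j,n}|\mid\mathcal C_n)<\infty$ a.s., so that $\mathbb E_{\mathcal C_n}Y_{j,n}=\mathbb E(Y_{j,n}\mid\mathcal C_n)$ is defined. For $p\ge 1$ and $q\ge 1$ let $\|X\|_{L^p,\mathcal C_n}=[\mathbb E(|X|^p\mid\mathcal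 C_n)]^{1/p}\in[0,\infty]$ and $$\delta_{p,n}(j,i,\mathcal C_n)=\|Y_{j,n}-Y_{j,n,i}\|_{L^p,\mathcal C_n},\qquad \Delta_{p,q}(\mathcal C_n)=\frac1{n^q}\sum_{i=1}^n\Big[\sum_{j=1}^n\delta_{p,n}(j,i,\mathcal C_n)\Big]^q .$$ Let $C_p=\sqrt{p-1}$ for $p\ge 2$ and $C_p=\frac1{p-1}$ for $p\in(1,2)$. Then for every $p>1$ and every $n\ge 1$, $$\frac1n\Big\|\sum_{j=1}^n\big(Y_{j,n}-\mathbb E_{\mathcal C_n}Y_{j,n}\big)\Big\|_{L^p,\mathcal C_n}\le C_p\,\big\{\Delta_{p,\min\{p,2\}}(\mathcal C_n)\big\}^{1/\min\{p,2\}}\quad\text{a.s.}$$ Moreover, for every $p>1$, if $\Delta_{p,\min\{p,2\}}(\mathcal C_n)\to 0$ a.s. as $n\to\infty$, then $\frac1n\big\|\sum_{j=1}^n(Y_{j,n}-\mathbb E_{\mathcal C_n}Y_{j,n})\big\|_{L^p,\mathcal C_n}\to 0$ a.s. -/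

import Mathlib

open MeasureTheory ProbabilityTheory Filter Topology
open scoped ENNReal

namespace NetworkFDM

noncomputable section

/-- The (generalised) conditional expectation `E(X | C)` of a real random variable `X`, namely
`E(X⁺ | C) - E(X⁻ | C)`. It is the usual notion as soon as `E(|X| | C) < ∞` almost surely, and it is
Mathlib's `μ[X|C]` for integrable `X` (see `cExp_ae_eq_condExp`). -/
def cExp {Ω : Type*} (C : MeasurableSpace Ω) {mΩ : MeasurableSpace Ω} (μ : Measure Ω) (X : Ω → ℝ) :
    Ω → ℝ :=
  fun ω ↦ (μ⁻[fun x ↦ ENNReal.ofReal (X x)|C] ω).toReal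
    - (μ⁻[fun x ↦ ENNReal.ofReal (-X x)|C] ω).toReal

theorem cExp_ae_eq_condExp {Ω : Type*} (C : MeasurableSpace Ω)
    {mΩ : MeasurableSpace Ω} (μ : Measure Ω) {X : Ω → ℝ} (hX : Integrable X μ) :
    cExp C μ X =ᵐ[μ] μ[X|C] := by
  have h1 := toReal_condLExp C (μ := μ) (f := fun x ↦ ENNReal.ofReal (X x))
    hX.aemeasurable.ennreal_ofReal hX.lintegral_lt_top.ne
  have h2 := toReal_condLExp C (μ := μ) (f := fun x ↦ ENNReal.ofReal (-X x))
    hX.neg.aemeasurable.ennreal_ofReal hX.neg.lintegral_lt_top.ne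
  have h3 := condExp_sub (μ := μ) (m := C) hX.pos_part hX.neg_part
  have h4 : (fun a ↦ max (X a) 0) - (fun a ↦ max (-X a) 0) = X := by
    funext a
    exact max_zero_sub_eq_self (X a)
  rw [h4] at h3
  filter_upwards [h1, h2, h3] with ω h1 h2 h3
  simp only [ENNReal.toReal_ofReal'] at h1 h2
  rw [h3, cExp, h1, h2]
  rfl

/-- The conditional `L^p` norm `‖X‖_{L^p, C} = E(|X|^p | C)^{1/p}`, a `[0, ∞]`-valued function. -/
def cLpNorm {Ω : Type*} (C : MeasurableSpace Ω) {mΩ : MeasurableSpace Ω} (μ : Measure Ω) (p : ℝ)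
    (X : Ω → ℝ) : Ω → ℝ≥0∞ :=
  fun ω ↦ (μ⁻[fun x ↦ ‖X x‖ₑ ^ p|C] ω) ^ (1 / p)

/-- The random elements `X i` are conditionally independent given `C`. -/
def CondIndepGiven {Ω ι β : Type*} [MeasurableSpace β]
    (C : MeasurableSpace Ω) {mΩ : MeasurableSpace Ω} (μ : Measure Ω) (X : ι → Ω → β) : Prop :=
  ∀ (S : Finset ι) (s : ι → Set β), (∀ i ∈ S, MeasurableSet (s i)) →
    μ⟦⋂ i ∈ S, X i ⁻¹' s i|C⟧ =ᵐ[μ] ∏ i ∈ S, μ⟦X i ⁻¹' s i|C⟧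

/-- On standard Borel spaces this is Mathlib's conditional independence. -/
theorem condIndepGiven_iff {Ω ι β : Type*} [mβ : MeasurableSpace β]
    (C : MeasurableSpace Ω) {mΩ : MeasurableSpace Ω} [StandardBorelSpace Ω]
    (hC : C ≤ mΩ) (μ : Measure Ω) [IsFiniteMeasure μ] (X : ι → Ω → β) (hX : ∀ i, Measurable (X i)) :
    CondIndepGiven C μ X ↔ iCondIndepFun C hC X μ :=
  (iCondIndepFun_iff_condExp_inter_preimage_eq_mul (fun _ ↦ mβ) X hX).symm

/-- `X` and `X'` have the same conditional distribution given `C`. -/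
def SameCondLaw {Ω β : Type*} [MeasurableSpace β]
    (C : MeasurableSpace Ω) {mΩ : MeasurableSpace Ω} (μ : Measure Ω) (X X' : Ω → β) : Prop :=
  ∀ s : Set β, MeasurableSet s → μ⟦X ⁻¹' s|C⟧ =ᵐ[μ] μ⟦X' ⁻¹' s|C⟧

section Network

variable {Ω E : Type*} {n : ℕ}

/-- The outcomes `Y_j = F_j(e_1, …, e_n)`. -/
def outcome (F : Fin n → (Fin n → E) → ℝ) (e : Fin n → Ω → E) (j : Fin n) : Ω → ℝ :=
  fun ω ↦ F j (fun k ↦ e k ω)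

/-- The coupled outcomes `Y_{j,i} = F_j(e_1, …, e_{i-1}, e_i*, e_{i+1}, …, e_n)`. -/
def coupledOutcome (F : Fin n → (Fin n → E) → ℝ) (e e' : Fin n → Ω → E) (j i : Fin n) : Ω → ℝ :=
  fun ω ↦ F j (Function.update (fun k ↦ e k ω) i (e' i ω))

/-- The functional dependence measure `δ_p(j, i, C) = ‖Y_j - Y_{j,i}‖_{L^p, C}`. -/
def fdm (C : MeasurableSpace Ω) {mΩ : MeasurableSpace Ω} (μ : Measure Ω) (p : ℝ)
    (F : Fin n → (Fin n → E) → ℝ) (e e' : Fin n → Ω → E) (j i : Fin n) : Ω → ℝ≥0∞ :=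
  cLpNorm C μ p (fun ω ↦ outcome F e j ω - coupledOutcome F e e' j i ω)

/-- `Δ_{p,q}(C) = n^{-q} ∑_i (∑_j δ_p(j, i, C))^q`. -/
def Delta (C : MeasurableSpace Ω) {mΩ : MeasurableSpace Ω} (μ : Measure Ω) (p q : ℝ)
    (F : Fin n → (Fin n → E) → ℝ) (e e' : Fin n → Ω → E) : Ω → ℝ≥0∞ :=
  fun ω ↦ 1 / (n : ℝ≥0∞) ^ q * ∑ i, (∑ j, fdm C μ p F e e' j i ω) ^ q

/-- `(1/n) ‖∑_j (Y_j - E(Y_j | C))‖_{L^p, C}`. -/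
def avgNorm (C : MeasurableSpace Ω) {mΩ : MeasurableSpace Ω} (μ : Measure Ω) (p : ℝ)
    (F : Fin n → (Fin n → E) → ℝ) (e : Fin n → Ω → E) : Ω → ℝ≥0∞ :=
  fun ω ↦ 1 / (n : ℝ≥0∞)
    * cLpNorm C μ p (fun x ↦ ∑ j, (outcome F e j x - cExp C μ (outcome F e j) x)) ω

end Network

/-- `C_p = √(p-1)` for `p ≥ 2` and `C_p = 1/(p-1)` for `1 < p < 2`. -/
def Cconst (p : ℝ) : ℝ := if 2 ≤ p then Real.sqrt (p - 1) else 1 / (p - 1)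

end

end NetworkFDM

/-! Let `q = min p 2`. Given `C`, the vectors `e_k` have a random product law, and after an
independent copy of `e_i` is adjoined the law is still a product. For almost every `ω` the claim is
therefore an inequality for a function `G` on a product probability space: `‖G - 𝔼G‖_p^q ≤ C_p^q ∑ᵢ
‖G - Gᵢ‖_p^q`, where `Gᵢ` has its `i`-th coordinate resampled. Taking `G = ∑ⱼ Fⱼ` and using
Minkowski's inequality over `j` gives the theorem.

The product inequality is an Efron–Stein bound in `L^p`, proved by induction on the number of
coordinates (`lintegral_prod_sub_integral_rpow_le`, `lintegral_pi_sub_integral_rpow_le`). If `g` is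
the average of `G` over the first coordinate, then `G - 𝔼G = (g - 𝔼G) + (G - g)`. The second summand
is centred given the other coordinates, hence orthogonal to `|X|^(p-2) X` for `X = g - 𝔼G`. Jensen's
inequality bounds `‖G - g‖_p` by the effect of resampling the first coordinate, and bounds the
resampling effects on `g` by those on `G`.

The constant comes from `‖X + Y‖_p^q ≤ ‖X‖_p^q + C_p^q ‖Y‖_p^q` for such orthogonal pairs
(`lintegral_add_rpow_min_le`). For `p ≤ 2` it is a first-order expansion of `|x|^p` whose remainder
is controlled by Hölder continuity of the derivative. For `p ≥ 2` it follows from the 2-uniform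
smoothness of `L^p` and a doubling argument. -/

namespace NetworkFDM

/-! ### Scalar inequalities for `|x|^p` and its derivative. -/

/-- The duality map `x ↦ |x|^(p-2) x`, which is `1/p` times the derivative of `|x|^p`. -/
noncomputable def dualityMap (p x : ℝ) : ℝ := |x| ^ (p - 2) * x

theorem hasDerivAt_abs_rpow_dualityMap {p : ℝ} (hp : 1 < p) (x : ℝ) :
    HasDerivAt (fun x : ℝ ↦ |x| ^ p) (p * dualityMap p x) x := by
  simpa [dualityMap, mul_assoc] using hasDerivAt_abs_rpow x hp

theorem abs_dualityMap {p : ℝ} (hp : 1 < p) (x : ℝ) : |dualityMap p x| = |x| ^ (p - 1) := by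
  rcases eq_or_ne x 0 with rfl | hx
  · simp [dualityMap, Real.zero_rpow (by linarith : p - 1 ≠ 0)]
  · rw [dualityMap, abs_mul, abs_of_nonneg (by positivity : 0 ≤ |x| ^ (p - 2)),
      ← Real.rpow_add_one (abs_ne_zero.mpr hx)]
    ring_nf

theorem dualityMap_mul_self {p : ℝ} (hp : 1 < p) (x : ℝ) : dualityMap p x * x = |x| ^ p := by
  rcases eq_or_ne x 0 with rfl | hx
  · simp [Real.zero_rpow (by linarith : p ≠ 0)]
  · rw [dualityMap, mul_assoc, ← abs_mul_abs_self, ← mul_assoc,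
      ← Real.rpow_add_one (abs_ne_zero.mpr hx), ← Real.rpow_add_one (abs_ne_zero.mpr hx)]
    ring_nf

theorem dualityMap_neg (p x : ℝ) : dualityMap p (-x) = -dualityMap p x := by
  simp [dualityMap]

theorem dualityMap_of_nonneg {p x : ℝ} (hp : 1 < p) (hx : 0 ≤ x) :
    dualityMap p x = x ^ (p - 1) := by
  rw [← abs_of_nonneg (show 0 ≤ dualityMap p x by unfold dualityMap; positivity),
    abs_dualityMap hp, abs_of_nonneg hx]

theorem measurable_dualityMap (p : ℝ) : Measurable (dualityMap p) := by
  unfold dualityMap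
  exact (measurable_id.abs.pow_const _).mul measurable_id

theorem hasDerivAt_dualityMap {p : ℝ} (hp : 2 < p) (x : ℝ) :
    HasDerivAt (dualityMap p) ((p - 1) * |x| ^ (p - 2)) x := by
  have hne : ∀ y : ℝ, y ≠ 0 → HasDerivAt (dualityMap p) ((p - 1) * |y| ^ (p - 2)) y := by
    intro y hy
    have h1 := ((hasDerivAt_abs hy).rpow_const (p := p - 2)
      (Or.inl (abs_ne_zero.mpr hy))).mul (hasDerivAt_id y)
    refine h1.congr_deriv ?_
    have h2 : |y| ^ (p - 2) = |y| ^ (p - 2 - 1) * |y| := by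
      rw [← Real.rpow_add_one (abs_ne_zero.mpr hy)]; ring_nf
    have h3 : (SignType.sign y : ℝ) * y = |y| := sign_mul_self y
    simp only [id, mul_one]
    rw [h2, show (SignType.sign y : ℝ) * (p - 2) * |y| ^ (p - 2 - 1) * y
      = (p - 2) * |y| ^ (p - 2 - 1) * ((SignType.sign y : ℝ) * y) by ring, h3]
    ring
  have hcont : Continuous fun x : ℝ ↦ |x| ^ (p - 2) :=
    continuous_abs.rpow_const fun _ ↦ Or.inr (by linarith)
  rcases eq_or_ne x 0 with rfl | hx
  -- At the origin the derivative is the limit of the derivatives nearby, since `|x|^(p-2)` is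
  -- continuous for `p > 2`.
  · exact hasDerivAt_of_hasDerivAt_of_ne' (fun y hy ↦ hne y hy)
      (hcont.mul continuous_id).continuousAt (continuous_const.mul hcont).continuousAt 0
  · exact hne x hx

/-- The graph of `|x|^p` lies above its tangents. -/
theorem abs_rpow_tangent_le {p : ℝ} (hp : 1 < p) (x y : ℝ) :
    |x| ^ p + p * (dualityMap p x * y) ≤ |x + y| ^ p := by
  have hp0 : 0 < p := by linarith
  -- Young's inequality for `φ(x)(x + y)`, `φ` being the duality map: `φ(x) x` and
  -- `|φ(x)|^(p/(p-1))` both equal `|x|^p`, so it rearranges to the tangent bound.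
  have h1 := Real.young_inequality (dualityMap p x) (x + y)
    (Real.HolderConjugate.conjExponent hp).symm
  rw [abs_dualityMap hp, ← Real.rpow_mul (abs_nonneg x), Real.conjExponent,
    mul_div_cancel₀ _ (by linarith : p - 1 ≠ 0)] at h1
  have h2 := dualityMap_mul_self hp x
  have h3 : |x| ^ p / (p / (p - 1)) = |x| ^ p * (p - 1) / p := by
    field_simp
  rw [h3] at h1
  have h4 : |x| ^ p * (p - 1) / p + |x + y| ^ p / p
      = (|x| ^ p * (p - 1) + |x + y| ^ p) / p := by ring
  rw [h4, le_div_iff₀ hp0] at h1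
  nlinarith

/-- The cross term is at most the `p`-th power of the larger of `|x|` and `|y|`. This crude
domination makes it integrable for functions in `L^p`. -/
theorem abs_dualityMap_mul_le {p : ℝ} (hp : 1 < p) (x y : ℝ) :
    |dualityMap p x * y| ≤ |x| ^ p + |y| ^ p := by
  rw [abs_mul, abs_dualityMap hp]
  have key : ∀ a b : ℝ, 0 ≤ a → 0 ≤ b → a ≤ b → a ^ (p - 1) * b ≤ b ^ p ∧ b ^ (p - 1) * a ≤ b ^ p := by
    intro a b ha hb hab
    have hb' : b ^ p = b ^ (p - 1) * b := by
      rw [← Real.rpow_add_one' hb (by linarith)]; ring_nf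
    rw [hb']
    have := Real.rpow_le_rpow ha hab (by linarith : 0 ≤ p - 1)
    exact ⟨by gcongr, by gcongr⟩
  have hx : 0 ≤ |x| ^ p := by positivity
  have hy : 0 ≤ |y| ^ p := by positivity
  rcases le_total |x| |y| with h | h
  · linarith [(key _ _ (abs_nonneg x) (abs_nonneg y) h).1]
  · linarith [(key _ _ (abs_nonneg y) (abs_nonneg x) h).2]

/-- Midpoint concavity of `t ↦ t^r`. With `r = p - 1` it is the source of the constant `2^(2-p)`. -/
theorem rpow_add_rpow_le_two_rpow {r a b : ℝ} (hr0 : 0 ≤ r) (hr1 : r ≤ 1) (ha : 0 ≤ a)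
    (hb : 0 ≤ b) : a ^ r + b ^ r ≤ 2 ^ (1 - r) * (a + b) ^ r := by
  have h := (Real.concaveOn_rpow hr0 hr1).2 (Set.mem_Ici.mpr ha) (Set.mem_Ici.mpr hb)
    (by norm_num : (0 : ℝ) ≤ 1 / 2) (by norm_num : (0 : ℝ) ≤ 1 / 2) (by norm_num)
  simp only [smul_eq_mul] at h
  rw [← mul_add, ← mul_add, Real.mul_rpow (by norm_num) (by positivity)] at h
  have h2 : (2 : ℝ) ^ (1 - r) = 2 * (1 / 2) ^ r := by
    rw [Real.rpow_sub two_pos, Real.rpow_one, Real.div_rpow zero_le_one two_pos.le, Real.one_rpow]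
    ring
  rw [h2]
  linarith

theorem rpow_sub_rpow_le {r a b : ℝ} (hr0 : 0 ≤ r) (hr1 : r ≤ 1) (hb : 0 ≤ b) (hab : b ≤ a) :
    a ^ r - b ^ r ≤ (a - b) ^ r := by
  have := Real.rpow_add_le_add_rpow (sub_nonneg.mpr hab) hb hr0 hr1
  rw [sub_add_cancel] at this
  linarith

/-- For `p ≤ 2` the duality map is Hölder continuous of exponent `p - 1`. -/
theorem dualityMap_sub_le {p : ℝ} (hp : 1 < p) (hp2 : p ≤ 2) {a b : ℝ} (hab : b ≤ a) :
    dualityMap p a - dualityMap p b ≤ 2 ^ (2 - p) * (a - b) ^ (p - 1) := by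
  have hr0 : 0 ≤ p - 1 := by linarith
  have hr1 : p - 1 ≤ 1 := by linarith
  have h1 : (1 : ℝ) ≤ 2 ^ (2 - p) := Real.one_le_rpow one_le_two (by linarith)
  have h0 : 0 ≤ (a - b) ^ (p - 1) := Real.rpow_nonneg (sub_nonneg.mpr hab) _
  have hdom : ∀ z, z ≤ (a - b) ^ (p - 1) → z ≤ 2 ^ (2 - p) * (a - b) ^ (p - 1) :=
    fun z hz ↦ hz.trans (le_mul_of_one_le_left h0 h1)
  have hneg : ∀ x : ℝ, x ≤ 0 → dualityMap p x = -(-x) ^ (p - 1) := fun x hx ↦ by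
    rw [← dualityMap_of_nonneg hp (neg_nonneg.mpr hx), dualityMap_neg, neg_neg]
  rcases le_total 0 b with hb | hb
  · rw [dualityMap_of_nonneg hp hb, dualityMap_of_nonneg hp (hb.trans hab)]
    exact hdom _ (rpow_sub_rpow_le hr0 hr1 hb hab)
  rcases le_total 0 a with ha | ha
  · rw [dualityMap_of_nonneg hp ha, hneg b hb, sub_neg_eq_add]
    have := rpow_add_rpow_le_two_rpow hr0 hr1 ha (neg_nonneg.mpr hb)
    rwa [show 1 - (p - 1) = 2 - p by ring, ← sub_eq_add_neg] at this
  · rw [hneg a ha, hneg b hb]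
    have := rpow_sub_rpow_le hr0 hr1 (neg_nonneg.mpr ha) (neg_le_neg hab)
    rw [show -b - -a = a - b by ring] at this
    exact hdom _ (by linarith)

/-- For `p ≤ 2`, the remainder of the first-order expansion of `|x|^p`. -/
theorem abs_add_rpow_le {p : ℝ} (hp : 1 < p) (hp2 : p ≤ 2) (x y : ℝ) :
    |x + y| ^ p ≤ |x| ^ p + p * (dualityMap p x * y) + 2 ^ (2 - p) * |y| ^ p := by
  have hp0 : p ≠ 0 := by linarith
  wlog hy : 0 ≤ y generalizing x y
  · have h := this (-x) (-y) (by linarith)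
    rwa [← neg_add, abs_neg, abs_neg, abs_neg, dualityMap_neg, neg_mul_neg] at h
  -- On `t > 0` the derivative of `r` is nonpositive exactly by the Hölder bound for the duality map
  -- between `x` and `x + t`; comparing `r y` with `r 0` gives the claim.
  set r : ℝ → ℝ := fun t ↦ |x + t| ^ p - p * (dualityMap p x * t) - 2 ^ (2 - p) * |t| ^ p with hr
  have hd : ∀ t, HasDerivAt r (p * dualityMap p (x + t) - p * dualityMap p x
      - 2 ^ (2 - p) * (p * dualityMap p t)) t := by
    intro t
    have h1 := (hasDerivAt_abs_rpow_dualityMap hp (x + t)).comp_const_add x t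
    have h2 := ((hasDerivAt_id t).const_mul (dualityMap p x)).const_mul p
    have h3 := (hasDerivAt_abs_rpow_dualityMap hp t).const_mul ((2 : ℝ) ^ (2 - p))
    refine ((h1.sub h2).sub h3).congr_deriv ?_
    simp
  have hanti : AntitoneOn r (Set.Ici 0) := by
    refine antitoneOn_of_deriv_nonpos (convex_Ici 0)
      (fun t _ ↦ (hd t).continuousAt.continuousWithinAt)
      (fun t _ ↦ (hd t).differentiableAt.differentiableWithinAt) fun t ht ↦ ?_
    rw [interior_Ici, Set.mem_Ioi] at ht
    rw [(hd t).deriv, dualityMap_of_nonneg hp ht.le]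
    have h := dualityMap_sub_le hp hp2 (show x ≤ x + t by linarith)
    rw [add_sub_cancel_left] at h
    nlinarith
  have h := hanti Set.self_mem_Ici (Set.mem_Ici.mpr hy) hy
  simp only [hr, add_zero, mul_zero, abs_zero, Real.zero_rpow hp0, sub_zero] at h
  linarith

theorem half_add_rpow_le {r a b : ℝ} (hr0 : 0 ≤ r) (hr1 : r ≤ 1) (ha : 0 ≤ a) (hb : 0 ≤ b) :
    (a ^ r + b ^ r) / 2 ≤ ((a + b) / 2) ^ r := by
  have h := rpow_add_rpow_le_two_rpow hr0 hr1 ha hb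
  rw [Real.rpow_sub two_pos, Real.rpow_one] at h
  rw [Real.div_rpow (by positivity) two_pos.le]
  have h2 : (0 : ℝ) < 2 ^ r := by positivity
  calc (a ^ r + b ^ r) / 2 ≤ (2 / 2 ^ r * (a + b) ^ r) / 2 := by gcongr
    _ = _ := by field_simp

/-- The two-point inequality behind the `2`-uniform smoothness of `L^p`, `p ≥ 2`. -/
theorem two_point_smoothness {p : ℝ} (hp : 2 ≤ p) (u v : ℝ) :
    (|u + v| ^ p + |u - v| ^ p) / 2 ≤ (u ^ 2 + (p - 1) * v ^ 2) ^ (p / 2) := by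
  have hp0 : 0 < p := by linarith
  rcases hp.eq_or_lt with rfl | hp2
  · norm_num
    nlinarith
  rcases eq_or_ne u 0 with rfl | hu
  · have h1 : |v| ^ p = (v ^ 2) ^ (p / 2) := by
      rw [← sq_abs, ← Real.rpow_natCast, ← Real.rpow_mul (abs_nonneg v)]
      congr 1; push_cast; ring
    simp only [zero_add, zero_sub, abs_neg, add_self_div_two]
    rw [h1]
    refine Real.rpow_le_rpow (sq_nonneg v) ?_ (by positivity)
    nlinarith [sq_nonneg v]
  -- The function `k t = h t ^ (2/p) - (p-1) v² t²` is even and concave, so `k 1 ≤ k 0 = u²`, which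
  -- is the claim. Since `u ≠ 0`, `h` never vanishes and its powers are differentiable.
  set h : ℝ → ℝ := fun t ↦ (|u + t * v| ^ p + |u - t * v| ^ p) / 2 with hh
  set h' : ℝ → ℝ := fun t ↦ p * v / 2 * (dualityMap p (u + t * v) - dualityMap p (u - t * v))
    with hh'
  set h'' : ℝ → ℝ := fun t ↦
    p * (p - 1) * v ^ 2 * ((|u + t * v| ^ (p - 2) + |u - t * v| ^ (p - 2)) / 2) with hh''
  have hlin1 : ∀ t, HasDerivAt (fun t : ℝ ↦ u + t * v) v t := fun t ↦ by
    simpa using ((hasDerivAt_id t).mul_const v).const_add u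
  have hlin2 : ∀ t, HasDerivAt (fun t : ℝ ↦ u - t * v) (-v) t := fun t ↦ by
    simpa using ((hasDerivAt_id t).mul_const v).const_sub u
  have hd1 : ∀ t, HasDerivAt h (h' t) t := fun t ↦ by
    have e1 := (hasDerivAt_abs_rpow_dualityMap (by linarith : 1 < p) _).comp t (hlin1 t)
    have e2 := (hasDerivAt_abs_rpow_dualityMap (by linarith : 1 < p) _).comp t (hlin2 t)
    refine ((e1.add e2).div_const 2).congr_deriv ?_
    simp only [hh']; ring
  have hd2 : ∀ t, HasDerivAt h' (h'' t) t := fun t ↦ by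
    have e1 := (hasDerivAt_dualityMap hp2 _).comp t (hlin1 t)
    have e2 := (hasDerivAt_dualityMap hp2 _).comp t (hlin2 t)
    refine ((e1.sub e2).const_mul (p * v / 2)).congr_deriv ?_
    simp only [hh'']; ring
  have hpos : ∀ t, 0 < h t := fun t ↦ by
    have n1 : 0 ≤ |u + t * v| ^ p := by positivity
    have n2 : 0 ≤ |u - t * v| ^ p := by positivity
    rcases eq_or_ne (u + t * v) 0 with h0 | h0
    · have : 0 < |u - t * v| ^ p := by
        refine Real.rpow_pos_of_pos (abs_pos.mpr fun h1 ↦ hu ?_) _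
        linarith
      simp only [hh]; linarith
    · have : 0 < |u + t * v| ^ p := Real.rpow_pos_of_pos (abs_pos.mpr h0) _
      simp only [hh]; linarith
  have hbound : ∀ t, h'' t ≤ p * (p - 1) * v ^ 2 * h t ^ (1 - 2 / p) := fun t ↦ by
    have key := half_add_rpow_le (r := 1 - 2 / p) (a := |u + t * v| ^ p) (b := |u - t * v| ^ p)
      (by rw [sub_nonneg, div_le_one hp0]; exact hp) (by linarith [div_nonneg two_pos.le hp0.le])
      (by positivity) (by positivity)
    rw [← Real.rpow_mul (abs_nonneg _), ← Real.rpow_mul (abs_nonneg _),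
      show p * (1 - 2 / p) = p - 2 by field_simp] at key
    have : 0 ≤ p * (p - 1) * v ^ 2 := by
      have : 0 ≤ p - 1 := by linarith
      positivity
    exact mul_le_mul_of_nonneg_left key this
  set k : ℝ → ℝ := fun t ↦ h t ^ (2 / p) - (p - 1) * v ^ 2 * t ^ 2 with hk
  set k' : ℝ → ℝ := fun t ↦ h' t * (2 / p) * h t ^ (2 / p - 1) - (p - 1) * v ^ 2 * (2 * t) with hk'
  have hkd : ∀ t, HasDerivAt k (k' t) t := fun t ↦ by
    have e1 := (hd1 t).rpow_const (p := 2 / p) (Or.inl (hpos t).ne')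
    have e2 := (hasDerivAt_pow 2 t).const_mul ((p - 1) * v ^ 2)
    refine (e1.sub e2).congr_deriv ?_
    simp [hk']
  have hkd2 : ∀ t, HasDerivAt k' ((h'' t * (2 / p)) * h t ^ (2 / p - 1)
      + (h' t * (2 / p)) * (h' t * (2 / p - 1) * h t ^ (2 / p - 1 - 1))
      - (p - 1) * v ^ 2 * 2) t := fun t ↦ by
    have e1 := ((hd2 t).mul_const (2 / p)).mul
      ((hd1 t).rpow_const (p := 2 / p - 1) (Or.inl (hpos t).ne'))
    have e2 := ((hasDerivAt_id t).const_mul 2).const_mul ((p - 1) * v ^ 2)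
    refine (e1.sub e2).congr_deriv ?_
    simp
  -- In `k''`, the term containing `h''` is at most `2(p-1)v²` by `hbound`, which the quadratic
  -- correction cancels; the term containing `h'²` carries the factor `2/p - 1 ≤ 0`.
  have hconc : ConcaveOn ℝ Set.univ k := by
    refine concaveOn_of_hasDerivWithinAt2_nonpos convex_univ
      (fun t _ ↦ (hkd t).continuousAt.continuousWithinAt)
      (fun t _ ↦ (hkd t).hasDerivWithinAt) (fun t _ ↦ (hkd2 t).hasDerivWithinAt) fun t _ ↦ ?_
    have a1 : h'' t * (2 / p) * h t ^ (2 / p - 1) ≤ (p - 1) * v ^ 2 * 2 := by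
      have pos1 : 0 ≤ h t ^ (2 / p - 1) := Real.rpow_nonneg (hpos t).le _
      calc h'' t * (2 / p) * h t ^ (2 / p - 1)
          ≤ p * (p - 1) * v ^ 2 * h t ^ (1 - 2 / p) * (2 / p) * h t ^ (2 / p - 1) := by
            gcongr
            exact hbound t
        _ = (p - 1) * v ^ 2 * 2 * (h t ^ (1 - 2 / p) * h t ^ (2 / p - 1)) := by field_simp
        _ = (p - 1) * v ^ 2 * 2 := by
            rw [← Real.rpow_add (hpos t), sub_add_sub_cancel, sub_self, Real.rpow_zero, mul_one]
    have a2 : (h' t * (2 / p)) * (h' t * (2 / p - 1) * h t ^ (2 / p - 1 - 1)) ≤ 0 := by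
      have : 2 / p - 1 ≤ 0 := by rw [sub_nonpos, div_le_one hp0]; exact hp
      have pos2 : 0 ≤ h t ^ (2 / p - 1 - 1) := Real.rpow_nonneg (hpos t).le _
      have pos3 : 0 ≤ h' t ^ 2 * (2 / p) * h t ^ (2 / p - 1 - 1) := by positivity
      nlinarith
    linarith
  have hsym : k (-1) = k 1 := by
    simp only [hk, hh]
    congr 2
    · congr 1
      rw [add_comm]
      congr 3 <;> ring
    · norm_num
  have hfin := hconc.2 (Set.mem_univ (-1)) (Set.mem_univ 1) (by norm_num : (0 : ℝ) ≤ 1 / 2)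
    (by norm_num : (0 : ℝ) ≤ 1 / 2) (by norm_num)
  simp only [smul_eq_mul, hsym] at hfin
  norm_num at hfin
  have hk1 : k 1 ≤ k 0 := by linarith
  have hk0 : k 0 = u ^ 2 := by
    simp only [hk, hh, zero_mul, add_zero, sub_zero, add_self_div_two]
    rw [← Real.rpow_mul (abs_nonneg u), mul_div_cancel₀ _ hp0.ne']
    simp
  have h1 : h 1 ^ (2 / p) ≤ u ^ 2 + (p - 1) * v ^ 2 := by
    rw [hk0] at hk1
    simp only [hk, one_pow, mul_one] at hk1
    linarith
  have h2 := Real.rpow_le_rpow (Real.rpow_nonneg (hpos 1).le _) h1 (by positivity : 0 ≤ p / 2)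
  rw [← Real.rpow_mul (hpos 1).le, show 2 / p * (p / 2) = 1 by field_simp, Real.rpow_one] at h2
  simpa [hh] using h2

theorem enorm_rpow_eq_ofReal {p : ℝ} (hp : 0 ≤ p) (x : ℝ) :
    ‖x‖ₑ ^ p = ENNReal.ofReal (|x| ^ p) := by
  rw [← ENNReal.ofReal_rpow_of_nonneg (abs_nonneg x) hp, Real.enorm_eq_ofReal_abs]

/-! ### Type and smoothness inequalities in `L^p`. -/

section Lp

variable {S : Type*} {mS : MeasurableSpace S} {P : Measure S} {p : ℝ} {X Y : S → ℝ}

theorem memLp_ofReal_iff (hp : 0 < p) (hX : AEStronglyMeasurable X P) :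
    MemLp X (ENNReal.ofReal p) P ↔ ∫⁻ s, ‖X s‖ₑ ^ p ∂P < ∞ := by
  rw [MemLp, and_iff_right hX, eLpNorm_lt_top_iff_lintegral_rpow_enorm_lt_top
    (by simpa using hp) ENNReal.ofReal_ne_top, ENNReal.toReal_ofReal hp.le]

theorem integrable_abs_rpow (hp : 0 < p) (hX : MemLp X (ENNReal.ofReal p) P) :
    Integrable (fun s ↦ |X s| ^ p) P := by
  have h := hX.integrable_norm_rpow (by simpa using hp) ENNReal.ofReal_ne_top
  rwa [ENNReal.toReal_ofReal hp.le] at h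

theorem lintegral_enorm_rpow_eq_ofReal (hp : 0 < p) (hX : MemLp X (ENNReal.ofReal p) P) :
    ∫⁻ s, ‖X s‖ₑ ^ p ∂P = ENNReal.ofReal (∫ s, |X s| ^ p ∂P) := by
  rw [ofReal_integral_eq_lintegral_ofReal (integrable_abs_rpow hp hX)
    (ae_of_all _ fun s ↦ by positivity)]
  simp_rw [enorm_rpow_eq_ofReal hp.le]

theorem integrable_dualityMap_mul (hp : 1 < p) (hX : MemLp X (ENNReal.ofReal p) P)
    (hY : MemLp Y (ENNReal.ofReal p) P) : Integrable (fun s ↦ dualityMap p (X s) * Y s) P := by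
  have hp0 : 0 < p := by linarith
  refine ((integrable_abs_rpow hp0 hX).add (integrable_abs_rpow hp0 hY)).mono' ?_ ?_
  · exact ((measurable_dualityMap p).comp_aemeasurable hX.1.aemeasurable).aestronglyMeasurable.mul
      hY.1
  · exact ae_of_all _ fun s ↦ abs_dualityMap_mul_le hp _ _

/-- Adding an element orthogonal to `|X|^(p-2) X` does not decrease the `L^p` norm. -/
theorem lintegral_rpow_le_of_orthogonal (hp : 1 < p) (hX : MemLp X (ENNReal.ofReal p) P)
    (hY : MemLp Y (ENNReal.ofReal p) P) (h0 : ∫ s, dualityMap p (X s) * Y s ∂P = 0) :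
    ∫⁻ s, ‖X s‖ₑ ^ p ∂P ≤ ∫⁻ s, ‖X s + Y s‖ₑ ^ p ∂P := by
  have hp0 : 0 < p := by linarith
  have hXY : MemLp (fun s ↦ X s + Y s) (ENNReal.ofReal p) P := hX.add hY
  rw [lintegral_enorm_rpow_eq_ofReal hp0 hX, lintegral_enorm_rpow_eq_ofReal hp0 hXY]
  refine ENNReal.ofReal_le_ofReal ?_
  have hint := (integrable_dualityMap_mul hp hX hY).const_mul p
  calc ∫ s, |X s| ^ p ∂P = ∫ s, (|X s| ^ p + p * (dualityMap p (X s) * Y s)) ∂P := by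
        rw [integral_add (integrable_abs_rpow hp0 hX) hint, integral_const_mul, h0, mul_zero,
          add_zero]
    _ ≤ _ := integral_mono ((integrable_abs_rpow hp0 hX).add hint)
        (integrable_abs_rpow hp0 hXY) fun s ↦ abs_rpow_tangent_le hp _ _

/-- The type `p` inequality for `L^p`, `1 < p ≤ 2`. -/
theorem lintegral_add_rpow_le (hp : 1 < p) (hp2 : p ≤ 2) (hX : MemLp X (ENNReal.ofReal p) P)
    (hY : MemLp Y (ENNReal.ofReal p) P) (h0 : ∫ s, dualityMap p (X s) * Y s ∂P = 0) :
    ∫⁻ s, ‖X s + Y s‖ₑ ^ p ∂P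
      ≤ ∫⁻ s, ‖X s‖ₑ ^ p ∂P + ENNReal.ofReal (2 ^ (2 - p)) * ∫⁻ s, ‖Y s‖ₑ ^ p ∂P := by
  have hp0 : 0 < p := by linarith
  have hXY : MemLp (fun s ↦ X s + Y s) (ENNReal.ofReal p) P := hX.add hY
  rw [lintegral_enorm_rpow_eq_ofReal hp0 hX, lintegral_enorm_rpow_eq_ofReal hp0 hY,
    lintegral_enorm_rpow_eq_ofReal hp0 hXY, ← ENNReal.ofReal_mul (by positivity),
    ← ENNReal.ofReal_add (integral_nonneg fun s ↦ by positivity)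
      (mul_nonneg (by positivity) (integral_nonneg fun s ↦ by positivity))]
  refine ENNReal.ofReal_le_ofReal ?_
  have hint := (integrable_dualityMap_mul hp hX hY).const_mul p
  have hintY := (integrable_abs_rpow hp0 hY).const_mul ((2 : ℝ) ^ (2 - p))
  have hintX := integrable_abs_rpow hp0 hX
  have hsum : Integrable (fun s ↦ |X s| ^ p + p * (dualityMap p (X s) * Y s)) P := hintX.add hint
  calc _ ≤ ∫ s, (|X s| ^ p + p * (dualityMap p (X s) * Y s) + 2 ^ (2 - p) * |Y s| ^ p) ∂P :=
        integral_mono (integrable_abs_rpow hp0 hXY) (hsum.add hintY)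
          fun s ↦ abs_add_rpow_le hp hp2 _ _
    _ = _ := by
        rw [integral_add hsum hintY, integral_add hintX hint, integral_const_mul,
          integral_const_mul, h0, mul_zero, add_zero]

theorem enorm_two_point_smoothness (hp : 2 ≤ p) (u v : ℝ) :
    2⁻¹ * ‖u + v‖ₑ ^ p + 2⁻¹ * ‖u - v‖ₑ ^ p
      ≤ (‖u‖ₑ ^ (2 : ℝ) + ENNReal.ofReal (p - 1) * ‖v‖ₑ ^ (2 : ℝ)) ^ (p / 2) := by
  have hp0 : 0 ≤ p := by linarith
  have hp1 : 0 ≤ p - 1 := by linarith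
  have h := ENNReal.ofReal_le_ofReal (two_point_smoothness hp u v)
  have e2 : (2⁻¹ : ℝ≥0∞) = ENNReal.ofReal 2⁻¹ := by
    rw [ENNReal.ofReal_inv_of_pos two_pos]; simp
  rw [enorm_rpow_eq_ofReal hp0, enorm_rpow_eq_ofReal hp0, enorm_rpow_eq_ofReal two_pos.le,
    enorm_rpow_eq_ofReal two_pos.le, e2, ← ENNReal.ofReal_mul (by norm_num),
    ← ENNReal.ofReal_mul (by norm_num), ← ENNReal.ofReal_mul hp1,
    ← ENNReal.ofReal_add (by positivity) (by positivity),
    ← ENNReal.ofReal_add (by positivity) (by positivity),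
    ENNReal.ofReal_rpow_of_nonneg (by positivity) (by positivity)]
  simp only [Real.rpow_two, sq_abs]
  convert h using 2
  ring

/-- `2`-uniform smoothness of `L^p`, `p ≥ 2`, with the sharp constant. -/
theorem lintegral_smoothness (hp : 2 ≤ p) (hX : AEMeasurable X P) (hY : AEMeasurable Y P) :
    (∫⁻ s, ‖X s + Y s‖ₑ ^ p ∂P) ^ (2 / p) + (∫⁻ s, ‖X s - Y s‖ₑ ^ p ∂P) ^ (2 / p)
      ≤ 2 * ((∫⁻ s, ‖X s‖ₑ ^ p ∂P) ^ (2 / p)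
        + ENNReal.ofReal (p - 1) * (∫⁻ s, ‖Y s‖ₑ ^ p ∂P) ^ (2 / p)) := by
  have hp0 : 0 < p := by linarith
  have hr : 1 ≤ p / 2 := by linarith
  have hr0 : 0 < p / 2 := by linarith
  have hrinv : 1 / (p / 2) = 2 / p := by field_simp
  set A := ∫⁻ s, ‖X s + Y s‖ₑ ^ p ∂P with hA
  set B := ∫⁻ s, ‖X s - Y s‖ₑ ^ p ∂P with hB
  have half : (2⁻¹ : ℝ≥0∞) + 2⁻¹ = 1 := ENNReal.inv_two_add_inv_two
  -- Three bounds are chained: convexity of `t^(p/2)`, the integrated two-point inequality, and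
  -- Minkowski's inequality in `L^(p/2)` for `|X|²` and `(p-1)|Y|²`.
  have h1 : (2⁻¹ * A ^ (2 / p) + 2⁻¹ * B ^ (2 / p)) ^ (p / 2) ≤ 2⁻¹ * A + 2⁻¹ * B := by
    have := ENNReal.rpow_arith_mean_le_arith_mean2_rpow 2⁻¹ 2⁻¹ (A ^ (2 / p)) (B ^ (2 / p)) half hr
    rwa [← ENNReal.rpow_mul, ← ENNReal.rpow_mul, show 2 / p * (p / 2) = 1 by field_simp,
      ENNReal.rpow_one, ENNReal.rpow_one] at this
  have hmA : AEMeasurable (fun s ↦ ‖X s + Y s‖ₑ ^ p) P := (hX.add hY).enorm.pow_const p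
  have hmB : AEMeasurable (fun s ↦ ‖X s - Y s‖ₑ ^ p) P := (hX.sub hY).enorm.pow_const p
  have h2 : 2⁻¹ * A + 2⁻¹ * B ≤ ∫⁻ s, ((fun s ↦ ‖X s‖ₑ ^ (2 : ℝ))
      + fun s ↦ ENNReal.ofReal (p - 1) * ‖Y s‖ₑ ^ (2 : ℝ)) s ^ (p / 2) ∂P := by
    rw [hA, hB, ← lintegral_const_mul' _ _ (by simp), ← lintegral_const_mul' _ _ (by simp),
      ← lintegral_add_left' (hmA.const_mul _)]
    exact lintegral_mono fun s ↦ enorm_two_point_smoothness hp _ _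
  have h3 := ENNReal.lintegral_Lp_add_le (μ := P) (f := fun s ↦ ‖X s‖ₑ ^ (2 : ℝ))
    (g := fun s ↦ ENNReal.ofReal (p - 1) * ‖Y s‖ₑ ^ (2 : ℝ)) (hX.enorm.pow_const _)
    ((hY.enorm.pow_const _).const_mul _) hr
  have e1 : ∫⁻ s, (‖X s‖ₑ ^ (2 : ℝ)) ^ (p / 2) ∂P = ∫⁻ s, ‖X s‖ₑ ^ p ∂P := by
    simp_rw [← ENNReal.rpow_mul, show 2 * (p / 2) = p by ring]
  have e2 : ∫⁻ s, (ENNReal.ofReal (p - 1) * ‖Y s‖ₑ ^ (2 : ℝ)) ^ (p / 2) ∂P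
      = ENNReal.ofReal (p - 1) ^ (p / 2) * ∫⁻ s, ‖Y s‖ₑ ^ p ∂P := by
    simp_rw [ENNReal.mul_rpow_of_nonneg _ _ hr0.le, ← ENNReal.rpow_mul,
      show 2 * (p / 2) = p by ring]
    rw [lintegral_const_mul' _ _ (ENNReal.rpow_ne_top_of_nonneg hr0.le ENNReal.ofReal_ne_top)]
  rw [hrinv, e1, e2, ENNReal.mul_rpow_of_nonneg _ _ (by positivity), ← ENNReal.rpow_mul,
    show p / 2 * (2 / p) = 1 by field_simp, ENNReal.rpow_one] at h3
  have h4 := (ENNReal.rpow_le_rpow (h1.trans h2) (by positivity : 0 ≤ 2 / p)).trans h3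
  rw [← ENNReal.rpow_mul, show p / 2 * (2 / p) = 1 by field_simp, ENNReal.rpow_one,
    ← mul_add] at h4
  rwa [ENNReal.inv_mul_le_iff (by simp) (by simp)] at h4

/-- The doubling argument that recovers the sharp constant in `2`-uniform smoothness. -/
theorem le_add_of_doubling {f : ℝ → ℝ} {K : ℝ}
    (hsmooth : ∀ s t, f (s + t) + f (s - t) ≤ 2 * (f s + t ^ 2 * K)) (hmin : ∀ t, f 0 ≤ f t) :
    f 1 ≤ f 0 + K := by
  -- Put `E(t) = f t - f 0 - t² K`. The smoothness hypothesis with both arguments equal to `t` reads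
  -- `E(2t) ≤ 2 E(t)`.
  have step : ∀ m : ℕ, f 1 - f 0 - K ≤ 2 ^ m * (f ((1 / 2) ^ m) - f 0 - (1 / 4) ^ m * K) := by
    intro m
    induction m with
    | zero => simp
    | succ m ih =>
      refine ih.trans ?_
      have h := hsmooth ((1 / 2) ^ (m + 1)) ((1 / 2) ^ (m + 1))
      rw [sub_self, ← two_mul, pow_succ (1 / 2 : ℝ) m,
        show 2 * ((1 / 2 : ℝ) ^ m * (1 / 2)) = (1 / 2) ^ m by ring, ← pow_succ] at h
      have e : ((1 / 2 : ℝ) ^ (m + 1)) ^ 2 = (1 / 4) ^ (m + 1) := by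
        rw [← pow_mul, mul_comm, pow_mul]; norm_num
      rw [e] at h
      have h2 : (0 : ℝ) < 2 ^ m := by positivity
      have e4 : (1 / 4 : ℝ) ^ m = 4 * (1 / 4) ^ (m + 1) := by rw [pow_succ]; ring
      rw [pow_succ (2 : ℝ) m, mul_assoc (2 ^ m : ℝ)]
      refine mul_le_mul_of_nonneg_left ?_ h2.le
      rw [e4]
      linarith
  have bound : ∀ m : ℕ, f 1 - f 0 - K ≤ (1 / 2) ^ m * K := by
    intro m
    refine (step m).trans ?_
    -- At `s = 0`, with `f(-t) ≥ f 0`, one gets `E(t) ≤ t² K`. For `t = 2^(-m)` the factor `2^m`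
    -- leaves only `2^(-m) K`, which tends to zero.
    have h := hsmooth 0 ((1 / 2) ^ m)
    have h' := hmin (0 - (1 / 2) ^ m)
    rw [zero_add] at h
    have e : ((1 / 2 : ℝ) ^ m) ^ 2 = (1 / 4) ^ m := by
      rw [← pow_mul, mul_comm, pow_mul]; norm_num
    rw [e] at h
    have e2 : (1 / 2 : ℝ) ^ m * K = 2 ^ m * ((1 / 4) ^ m * K) := by
      rw [← mul_assoc, ← mul_pow]; norm_num
    rw [e2]
    refine mul_le_mul_of_nonneg_left ?_ (by positivity)
    linarith
  have hlim : Tendsto (fun m : ℕ ↦ (1 / 2 : ℝ) ^ m * K) atTop (𝓝 (0 * K)) :=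
    (tendsto_pow_atTop_nhds_zero_of_lt_one (by norm_num) (by norm_num)).mul_const K
  have := ge_of_tendsto' hlim bound
  linarith

/-- The type `2` inequality for `L^p`, `p ≥ 2`, with the sharp constant `p - 1`. -/
theorem lintegral_add_rpow_two_le (hp : 2 ≤ p) (hX : MemLp X (ENNReal.ofReal p) P)
    (hY : MemLp Y (ENNReal.ofReal p) P) (h0 : ∫ s, dualityMap p (X s) * Y s ∂P = 0) :
    (∫⁻ s, ‖X s + Y s‖ₑ ^ p ∂P) ^ (2 / p)
      ≤ (∫⁻ s, ‖X s‖ₑ ^ p ∂P) ^ (2 / p)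
        + ENNReal.ofReal (p - 1) * (∫⁻ s, ‖Y s‖ₑ ^ p ∂P) ^ (2 / p) := by
  have hp0 : 0 < p := by linarith
  have hr : 0 ≤ 2 / p := by positivity
  have hfin : ∀ {Z : S → ℝ}, MemLp Z (ENNReal.ofReal p) P →
      (∫⁻ s, ‖Z s‖ₑ ^ p ∂P) ^ (2 / p) ≠ ∞ := fun hZ ↦
    ENNReal.rpow_ne_top_of_nonneg hr ((memLp_ofReal_iff hp0 hZ.1).mp hZ).ne
  have hmem : ∀ t : ℝ, MemLp (fun s ↦ X s + t * Y s) (ENNReal.ofReal p) P := fun t ↦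
    hX.add (hY.const_mul t)
  set K := (∫⁻ s, ‖Y s‖ₑ ^ p ∂P) ^ (2 / p) with hK
  have hKfin : K ≠ ∞ := hfin hY
  have hXY : MemLp (fun s ↦ X s + Y s) (ENNReal.ofReal p) P := hX.add hY
  -- Here `f t = ‖X + tY‖_p²`; by orthogonality it is minimal at `t = 0`. Smoothness at `t = 1`
  -- alone would lose a factor 2 in the constant.
  set f : ℝ → ℝ := fun t ↦ ((∫⁻ s, ‖X s + t * Y s‖ₑ ^ p ∂P) ^ (2 / p)).toReal with hf
  have hsmooth : ∀ s t, f (s + t) + f (s - t) ≤ 2 * (f s + t ^ 2 * ((p - 1) * K.toReal)) := by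
    intro s t
    have h := lintegral_smoothness hp (hmem s).1.aemeasurable (hY.const_mul t).1.aemeasurable
    have e1 : ∀ x, X x + s * Y x + t * Y x = X x + (s + t) * Y x := fun x ↦ by ring
    have e2 : ∀ x, X x + s * Y x - t * Y x = X x + (s - t) * Y x := fun x ↦ by ring
    have e3 : (∫⁻ x, ‖t * Y x‖ₑ ^ p ∂P) ^ (2 / p) = ENNReal.ofReal (t ^ 2) * K := by
      simp_rw [enorm_mul, ENNReal.mul_rpow_of_nonneg _ _ hp0.le]
      rw [lintegral_const_mul' _ _ (ENNReal.rpow_ne_top_of_nonneg hp0.le (by simp)),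
        ENNReal.mul_rpow_of_nonneg _ _ hr, ← ENNReal.rpow_mul, mul_div_cancel₀ _ hp0.ne',
        enorm_rpow_eq_ofReal two_pos.le, Real.rpow_two, sq_abs]
    simp_rw [e1, e2] at h
    rw [e3] at h
    have h' := ENNReal.toReal_mono (ENNReal.mul_ne_top (by simp) (ENNReal.add_ne_top.mpr
      ⟨hfin (hmem s), ENNReal.mul_ne_top (by simp) (ENNReal.mul_ne_top (by simp) hKfin)⟩)) h
    rw [ENNReal.toReal_add (hfin (hmem _)) (hfin (hmem _)), ENNReal.toReal_mul,
      ENNReal.toReal_add (hfin (hmem s)) (ENNReal.mul_ne_top (by simp)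
        (ENNReal.mul_ne_top (by simp) hKfin)), ENNReal.toReal_mul, ENNReal.toReal_mul,
      ENNReal.toReal_ofReal (sq_nonneg t), ENNReal.toReal_ofReal (by linarith)] at h'
    simp only [ENNReal.toReal_ofNat] at h'
    simp only [hf]
    linarith
  have hmin : ∀ t, f 0 ≤ f t := by
    intro t
    refine ENNReal.toReal_mono (hfin (hmem t)) (ENNReal.rpow_le_rpow ?_ hr)
    have := lintegral_rpow_le_of_orthogonal (by linarith) hX (hY.const_mul t) (by
      simp_rw [mul_left_comm _ t]; rw [integral_const_mul, h0, mul_zero])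
    simpa using this
  have h := le_add_of_doubling hsmooth hmin
  simp only [hf, one_mul, zero_mul, add_zero] at h
  have hK' : ENNReal.ofReal (p - 1) * K ≠ ∞ := ENNReal.mul_ne_top (by simp) hKfin
  have e : (p - 1) * K.toReal = (ENNReal.ofReal (p - 1) * K).toReal := by
    rw [ENNReal.toReal_mul, ENNReal.toReal_ofReal (by linarith)]
  rw [e, ← ENNReal.toReal_add (hfin hX) hK', ENNReal.toReal_le_toReal
    (hfin hXY) (ENNReal.add_ne_top.mpr ⟨hfin hX, hK'⟩)] at h
  exact h

/-- The expansion constant is absorbed into `C_p^p`: `2 ≤ e` and `p - 1 ≤ e^(p-2)` bound it by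
`1/(p-1)`, which is at least 1 and so does not exceed its `p`-th power. -/
theorem two_rpow_le_inv_rpow (hp : 1 < p) (hp2 : p ≤ 2) :
    (2 : ℝ) ^ (2 - p) ≤ (1 / (p - 1)) ^ p := by
  have hp1 : 0 < p - 1 := by linarith
  have h1 : (2 : ℝ) ^ (2 - p) ≤ Real.exp (2 - p) := by
    rw [← Real.exp_one_rpow]
    exact Real.rpow_le_rpow two_pos.le (by linarith [Real.add_one_le_exp (1 : ℝ)]) (by linarith)
  have h2 : Real.exp (2 - p) ≤ 1 / (p - 1) := by
    rw [le_div_iff₀ hp1]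
    have := Real.add_one_le_exp (p - 2)
    calc Real.exp (2 - p) * (p - 1) ≤ Real.exp (2 - p) * Real.exp (p - 2) := by
          gcongr; linarith
      _ = 1 := by rw [← Real.exp_add]; simp
  have h3 : (1 : ℝ) ≤ 1 / (p - 1) := by rw [le_div_iff₀ hp1]; linarith
  calc _ ≤ 1 / (p - 1) := h1.trans h2
    _ = (1 / (p - 1)) ^ (1 : ℝ) := (Real.rpow_one _).symm
    _ ≤ _ := Real.rpow_le_rpow_of_exponent_le h3 hp.le

/-- The common form of the type inequalities for `L^p`, with the constant `C_p`. -/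
theorem lintegral_add_rpow_min_le (hp : 1 < p) (hX : MemLp X (ENNReal.ofReal p) P)
    (hY : MemLp Y (ENNReal.ofReal p) P) (h0 : ∫ s, dualityMap p (X s) * Y s ∂P = 0) :
    (∫⁻ s, ‖X s + Y s‖ₑ ^ p ∂P) ^ (min p 2 / p)
      ≤ (∫⁻ s, ‖X s‖ₑ ^ p ∂P) ^ (min p 2 / p)
        + ENNReal.ofReal (Cconst p) ^ min p 2 * (∫⁻ s, ‖Y s‖ₑ ^ p ∂P) ^ (min p 2 / p) := by
  rcases le_or_gt 2 p with h2 | h2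
  · rw [min_eq_right h2]
    have e : ENNReal.ofReal (Cconst p) ^ (2 : ℝ) = ENNReal.ofReal (p - 1) := by
      rw [Cconst, if_pos h2, ENNReal.ofReal_rpow_of_nonneg (Real.sqrt_nonneg _) two_pos.le,
        Real.rpow_two, Real.sq_sqrt (by linarith)]
    rw [e]
    exact lintegral_add_rpow_two_le h2 hX hY h0
  · rw [min_eq_left h2.le, div_self (by linarith), ENNReal.rpow_one, ENNReal.rpow_one,
      ENNReal.rpow_one]
    refine (lintegral_add_rpow_le hp h2.le hX hY h0).trans ?_
    gcongr
    have hp1 : 0 < p - 1 := by linarith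
    rw [Cconst, if_neg h2.not_ge, ENNReal.ofReal_rpow_of_nonneg (by positivity) (by linarith)]
    exact ENNReal.ofReal_le_ofReal (two_rpow_le_inv_rpow hp h2.le)

end Lp

theorem Cconst_pos {p : ℝ} (hp : 1 < p) : 0 < Cconst p := by
  have hp1 : 0 < p - 1 := by linarith
  unfold Cconst
  split_ifs
  · exact Real.sqrt_pos.mpr hp1
  · positivity

/-! ### The moment inequality on product spaces. -/

section Tensorization

variable {A B : Type*} [MeasurableSpace A] [MeasurableSpace B] {p : ℝ}

theorem lintegral_enorm_rpow_le {ρ : Measure A} [IsProbabilityMeasure ρ] (hp : 1 ≤ p) {f : A → ℝ}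
    (hf : AEMeasurable f ρ) : (∫⁻ a, ‖f a‖ₑ ∂ρ) ^ p ≤ ∫⁻ a, ‖f a‖ₑ ^ p ∂ρ := by
  have hp0 : 0 < p := by linarith
  have h := eLpNorm_le_eLpNorm_of_exponent_le (μ := ρ) (p := 1) (q := ENNReal.ofReal p)
    (by simpa using ENNReal.ofReal_le_ofReal hp) hf.aestronglyMeasurable
  rw [eLpNorm_one_eq_lintegral_enorm, eLpNorm_eq_lintegral_rpow_enorm_toReal (by simpa using hp0)
    ENNReal.ofReal_ne_top, ENNReal.toReal_ofReal hp0.le] at h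
  have := ENNReal.rpow_le_rpow h hp0.le
  rwa [← ENNReal.rpow_mul, one_div, inv_mul_cancel₀ hp0.ne', ENNReal.rpow_one] at this

/-- Jensen's inequality; no integrability is needed, since the right-hand side is infinite when
exactly one of the two functions is integrable. -/
theorem enorm_integral_sub_rpow_le {ρ : Measure A} [IsProbabilityMeasure ρ] (hp : 1 ≤ p)
    {f g : A → ℝ} (hf : AEMeasurable f ρ) (hg : AEMeasurable g ρ) :
    ‖∫ a, f a ∂ρ - ∫ a, g a ∂ρ‖ₑ ^ p ≤ ∫⁻ a, ‖f a - g a‖ₑ ^ p ∂ρ := by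
  have hp0 : 0 < p := by linarith
  refine le_trans ?_ (lintegral_enorm_rpow_le hp (hf.sub hg))
  refine ENNReal.rpow_le_rpow ?_ hp0.le
  by_cases hsub : Integrable (fun a ↦ f a - g a) ρ
  · by_cases hfi : Integrable f ρ
    · have hgi : Integrable g ρ := by
        refine (hfi.sub hsub).congr (ae_of_all _ fun a ↦ ?_)
        simp
      rw [← integral_sub hfi hgi]
      exact enorm_integral_le_lintegral_enorm _
    -- Neither function is integrable, so both Bochner integrals take the default value 0 and the
    -- left-hand side vanishes.
    · have hgi : ¬ Integrable g ρ := fun hgi ↦ hfi <| by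
        refine (hsub.add hgi).congr (ae_of_all _ fun a ↦ ?_)
        simp
      rw [integral_undef hfi, integral_undef hgi]
      simp
  · have : ∫⁻ a, ‖f a - g a‖ₑ ∂ρ = ∞ := by
      by_contra h
      exact hsub ⟨(hf.sub hg).aestronglyMeasurable, Ne.lt_top h⟩
    exact le_top.trans_eq this.symm

/-- One step of the tensorization: integrating out the first coordinate. -/
theorem lintegral_prod_sub_integral_rpow_le {ρ : Measure A} {π : Measure B}
    [IsProbabilityMeasure ρ] [IsProbabilityMeasure π] (hp : 1 < p) {G : A × B → ℝ}
    (hG : Measurable G) (hGi : Integrable G (ρ.prod π)) (m : ℝ) :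
    (∫⁻ z, ‖G z - m‖ₑ ^ p ∂ρ.prod π) ^ (min p 2 / p)
      ≤ (∫⁻ b, ‖∫ a, G (a, b) ∂ρ - m‖ₑ ^ p ∂π) ^ (min p 2 / p)
        + ENNReal.ofReal (Cconst p) ^ min p 2
          * (∫⁻ y, ∫⁻ z, ‖G z - G (y, z.2)‖ₑ ^ p ∂ρ.prod π ∂ρ) ^ (min p 2 / p) := by
  have hp0 : 0 < p := by linarith
  have hr : 0 < min p 2 / p := div_pos (lt_min hp0 two_pos) hp0
  have hC : ENNReal.ofReal (Cconst p) ^ min p 2 ≠ 0 :=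
    (ENNReal.rpow_pos (by simpa using Cconst_pos hp) ENNReal.ofReal_ne_top).ne'
  set g : B → ℝ := fun b ↦ ∫ a, G (a, b) ∂ρ with hg
  have hgm : Measurable g := by
    have : StronglyMeasurable fun b ↦ ∫ a, G (a, b) ∂ρ :=
      hG.stronglyMeasurable.integral_prod_left'
    exact this.measurable
  have hX : ∫⁻ z : A × B, ‖g z.2 - m‖ₑ ^ p ∂ρ.prod π = ∫⁻ b, ‖g b - m‖ₑ ^ p ∂π :=
    (measurePreserving_snd (μ := ρ) (ν := π)).lintegral_comp
      ((hgm.sub_const m).enorm.pow_const p)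
  -- `G z - g z.2` is the average of `G z - G (y, z.2)` over an independent `y`, so Jensen's
  -- inequality applies.
  have hY : ∫⁻ z : A × B, ‖G z - g z.2‖ₑ ^ p ∂ρ.prod π
      ≤ ∫⁻ y, ∫⁻ z, ‖G z - G (y, z.2)‖ₑ ^ p ∂ρ.prod π ∂ρ := by
    rw [lintegral_lintegral_swap (by fun_prop)]
    refine lintegral_mono fun z ↦ ?_
    have h := enorm_integral_sub_rpow_le (ρ := ρ) (f := fun _ ↦ G z)
      (g := fun y ↦ G (y, z.2)) hp.le aemeasurable_const (by fun_prop)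
    simpa using h
  -- If either term on the right is infinite the bound is trivial; otherwise both summands lie in
  -- `L^p` and the cross term is integrable.
  by_cases hXt : ∫⁻ b, ‖g b - m‖ₑ ^ p ∂π = ∞
  · rw [hXt, ENNReal.top_rpow_of_pos hr, top_add]
    exact le_top
  by_cases hYt : ∫⁻ y, ∫⁻ z, ‖G z - G (y, z.2)‖ₑ ^ p ∂ρ.prod π ∂ρ = ∞
  · rw [hYt, ENNReal.top_rpow_of_pos hr, ENNReal.mul_top hC, add_top]
    exact le_top
  have hXL : MemLp (fun z : A × B ↦ g z.2 - m) (ENNReal.ofReal p) (ρ.prod π) := by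
    refine (memLp_ofReal_iff hp0
      ((hgm.comp measurable_snd).sub_const m).aestronglyMeasurable).mpr ?_
    exact hX.trans_lt (Ne.lt_top hXt)
  have hYL : MemLp (fun z : A × B ↦ G z - g z.2) (ENNReal.ofReal p) (ρ.prod π) := by
    refine (memLp_ofReal_iff hp0
      (hG.sub (hgm.comp measurable_snd)).aestronglyMeasurable).mpr ?_
    exact hY.trans_lt (Ne.lt_top hYt)
  -- By Fubini: for fixed `b` the duality factor is constant in `a`, while `G (a, b) - g b` has mean
  -- zero.
  have h0 : ∫ z : A × B, dualityMap p (g z.2 - m) * (G z - g z.2) ∂ρ.prod π = 0 := by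
    rw [integral_prod_symm _ (integrable_dualityMap_mul hp hXL hYL)]
    refine integral_eq_zero_of_ae ?_
    filter_upwards [hGi.prod_left_ae] with b hb
    rw [integral_const_mul, integral_sub hb (integrable_const _)]
    simp [hg]
  have h := lintegral_add_rpow_min_le hp hXL hYL h0
  simp only [sub_add_sub_cancel', hX] at h
  refine h.trans ?_
  gcongr

theorem measurableEmbedding_cons {E : Type*} [MeasurableSpace E] {n : ℕ} : MeasurableEmbedding
    (fun z : E × (Fin n → E) ↦ (Fin.cons z.1 z.2 : Fin (n + 1) → E)) := by
  have h := (MeasurableEquiv.piFinSuccAbove (fun _ : Fin (n + 1) ↦ E) 0).symm.measurableEmbedding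
  simpa [MeasurableEquiv.piFinSuccAbove, Fin.insertNthEquiv, Fin.insertNth_zero] using h

theorem measurePreserving_cons {E : Type*} [MeasurableSpace E] {n : ℕ}
    (ν : Fin (n + 1) → Measure E) [∀ i, SigmaFinite (ν i)] : MeasurePreserving
    (fun z : E × (Fin n → E) ↦ (Fin.cons z.1 z.2 : Fin (n + 1) → E))
    ((ν 0).prod (Measure.pi fun j ↦ ν j.succ)) (Measure.pi ν) := by
  have h := (measurePreserving_piFinSuccAbove ν 0).symm
  simpa [MeasurableEquiv.piFinSuccAbove, Fin.insertNthEquiv, Fin.insertNth_zero] using h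

/-- The tensorized moment inequality for functions of independent random elements. -/
theorem lintegral_pi_sub_integral_rpow_le {E : Type*} [MeasurableSpace E] (hp : 1 < p) {n : ℕ}
    (ν : Fin n → Measure E) [∀ i, IsProbabilityMeasure (ν i)] {G : (Fin n → E) → ℝ}
    (hG : Measurable G) (hGi : Integrable G (Measure.pi ν)) :
    (∫⁻ x, ‖G x - ∫ x, G x ∂Measure.pi ν‖ₑ ^ p ∂Measure.pi ν) ^ (min p 2 / p)
      ≤ ENNReal.ofReal (Cconst p) ^ min p 2
        * ∑ i, (∫⁻ y, ∫⁻ x, ‖G x - G (Function.update x i y)‖ₑ ^ p ∂Measure.pi ν ∂ν i)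
          ^ (min p 2 / p) := by
  have hp0 : 0 < p := by linarith
  have hr : 0 < min p 2 / p := div_pos (lt_min hp0 two_pos) hp0
  induction n with
  | zero =>
    have h : ∀ x, G x - ∫ x, G x ∂Measure.pi ν = 0 := fun x ↦ by
      rw [sub_eq_zero]
      have : ∀ y, G y = G x := fun y ↦ by rw [Subsingleton.elim y x]
      simp [this]
    simp [h, ENNReal.zero_rpow_of_pos hp0, ENNReal.zero_rpow_of_pos hr]
  | succ n ih =>
    set π : Measure (Fin n → E) := Measure.pi fun j ↦ ν j.succ with hπ
    have hmp : MeasurePreserving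
        (fun z : E × (Fin n → E) ↦ (Fin.cons z.1 z.2 : Fin (n + 1) → E))
        ((ν 0).prod π) (Measure.pi ν) := measurePreserving_cons ν
    have hemb := measurableEmbedding_cons (E := E) (n := n)
    set G' : E × (Fin n → E) → ℝ := fun z ↦ G (Fin.cons z.1 z.2) with hG'
    have hG'm : Measurable G' := hG.comp hmp.measurable
    have hG'i : Integrable G' ((ν 0).prod π) := (hmp.integrable_comp_emb hemb).mpr hGi
    set m := ∫ x, G x ∂Measure.pi ν with hm
    -- Averaging out a coordinate keeps the mean, so the one-step bound and the induction hypothesis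
    -- are centred at the same constant.
    have hm' : ∫ b, ∫ a, G' (a, b) ∂ν 0 ∂π = m := by
      rw [← integral_prod_symm _ hG'i, hm, ← hmp.integral_comp hemb]
    have hgm : Measurable fun b ↦ ∫ a, G' (a, b) ∂ν 0 :=
      hG'm.stronglyMeasurable.integral_prod_left'.measurable
    have hstep := lintegral_prod_sub_integral_rpow_le hp hG'm hG'i m
    have hind := ih (fun j ↦ ν j.succ) hgm hG'i.integral_prod_right
    rw [hm'] at hind
    rw [Fin.sum_univ_succ, mul_add, ← hmp.lintegral_comp_emb hemb]
    refine hstep.trans ((add_le_add (hind.trans ?_) ?_).trans (add_comm _ _).le)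
    -- Resampling a later coordinate commutes with averaging over the first, so Jensen's inequality
    -- passes from the averaged function back to `G`.
    · gcongr with i _ y
      have hu : Measurable fun z : E × (Fin n → E) ↦ G' (z.1, Function.update z.2 i y) :=
        hG'm.comp (measurable_fst.prodMk (measurable_update_left.comp measurable_snd))
      rw [← hmp.lintegral_comp_emb hemb]
      simp_rw [← Fin.cons_update]
      refine le_trans ?_
        (lintegral_prod_symm _ ((hG'm.sub hu).enorm.pow_const p).aemeasurable).ge
      refine lintegral_mono fun b ↦ ?_
      exact enorm_integral_sub_rpow_le hp.le (hG'm.comp measurable_prodMk_right).aemeasurable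
        (hu.comp measurable_prodMk_right).aemeasurable
    · simp_rw [← hmp.lintegral_comp_emb hemb, Fin.update_cons_zero]
      exact le_rfl

/-- The product inequality for `∑ⱼ Fⱼ`, followed by Minkowski's inequality over `j` on the product
of `ν i` with `Measure.pi ν`, and a root of order `min p 2`. -/
theorem lintegral_pi_sum_sub_integral_rpow_le {E ι : Type*} [MeasurableSpace E] [Fintype ι]
    (hp : 1 < p) {n : ℕ} (ν : Fin n → Measure E) [∀ i, IsProbabilityMeasure (ν i)]
    {F : ι → (Fin n → E) → ℝ} (hF : ∀ j, Measurable (F j))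
    (hFi : ∀ j, Integrable (F j) (Measure.pi ν)) :
    (∫⁻ x, ‖∑ j, (F j x - ∫ x, F j x ∂Measure.pi ν)‖ₑ ^ p ∂Measure.pi ν) ^ (1 / p)
      ≤ ENNReal.ofReal (Cconst p) * (∑ i, (∑ j, (∫⁻ y, ∫⁻ x,
          ‖F j x - F j (Function.update x i y)‖ₑ ^ p ∂Measure.pi ν ∂ν i) ^ (1 / p)) ^ min p 2)
          ^ (1 / min p 2) := by
  have hp0 : 0 < p := by linarith
  have hq : 0 < min p 2 := lt_min hp0 two_pos
  have hGm : Measurable fun x ↦ ∑ j, F j x := Finset.measurable_fun_sum _ fun j _ ↦ hF j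
  have hmain := lintegral_pi_sub_integral_rpow_le hp ν hGm (integrable_finsetSum _ fun j _ ↦ hFi j)
  rw [integral_finsetSum _ fun j _ ↦ hFi j] at hmain
  simp_rw [← Finset.sum_sub_distrib] at hmain
  have hupd : ∀ i : Fin n, Measurable fun z : E × (Fin n → E) ↦ Function.update z.2 i z.1 :=
    fun i ↦ measurable_pi_lambda _ fun k ↦ by
      rcases eq_or_ne k i with rfl | hk
      · simpa using measurable_fst
      · simpa [hk, Function.comp_def] using (measurable_pi_apply k).comp measurable_snd
  have hD : ∀ i j, Measurable fun z : E × (Fin n → E) ↦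
      F j z.2 - F j (Function.update z.2 i z.1) := fun i j ↦
    ((hF j).comp measurable_snd).sub ((hF j).comp (hupd i))
  have hmink : ∀ i : Fin n, (∫⁻ y, ∫⁻ x,
      ‖∑ j, (F j x - F j (Function.update x i y))‖ₑ ^ p ∂Measure.pi ν ∂ν i) ^ (1 / p)
      ≤ ∑ j, (∫⁻ y, ∫⁻ x,
        ‖F j x - F j (Function.update x i y)‖ₑ ^ p ∂Measure.pi ν ∂ν i) ^ (1 / p) := by
    intro i
    have h := eLpNorm'_sum_le (μ := (ν i).prod (Measure.pi ν)) (s := Finset.univ)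
      (f := fun j (z : E × (Fin n → E)) ↦ F j z.2 - F j (Function.update z.2 i z.1))
      (fun j _ ↦ (hD i j).aestronglyMeasurable) hp.le
    simp only [eLpNorm', Finset.sum_apply] at h
    rw [lintegral_prod _ ((Finset.measurable_fun_sum _ fun j _ ↦ hD i j).enorm.pow_const
      p).aemeasurable] at h
    refine h.trans_eq (Finset.sum_congr rfl fun j _ ↦ ?_)
    rw [lintegral_prod _ ((hD i j).enorm.pow_const p).aemeasurable]
  have hpow := ENNReal.rpow_le_rpow hmain (by positivity : 0 ≤ 1 / min p 2)
  rw [← ENNReal.rpow_mul, show min p 2 / p * (1 / min p 2) = 1 / p by field_simp,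
    ENNReal.mul_rpow_of_nonneg _ _ (by positivity), ← ENNReal.rpow_mul,
    mul_one_div_cancel hq.ne', ENNReal.rpow_one] at hpow
  refine hpow.trans ?_
  gcongr with i
  rw [show min p 2 / p = 1 / p * min p 2 by ring, ENNReal.rpow_mul]
  exact ENNReal.rpow_le_rpow (hmink i) hq.le

end Tensorization

/-- Serves both to drop the copy `e' i` from the family and to reindex `Option (Fin n)` by `Fin (n +
1)`. -/
theorem CondIndepGiven.comp_injective {Ω ι ι' β : Type*} [MeasurableSpace β]
    {C : MeasurableSpace Ω} {mΩ : MeasurableSpace Ω} {μ : Measure Ω} {X : ι → Ω → β}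
    (h : CondIndepGiven C μ X) {g : ι' → ι} (hg : Function.Injective g) :
    CondIndepGiven C μ (fun k ↦ X (g k)) := by
  intro S s hs
  have h' := h (S.map ⟨g, hg⟩) (Function.extend g s fun _ ↦ Set.univ) (by
    intro i hi
    obtain ⟨k, hk, rfl⟩ := Finset.mem_map.mp hi
    simpa [hg.extend_apply] using hs k hk)
  simpa [Finset.prod_map, hg.extend_apply] using h'

/-! ### Regular conditional distributions. -/

section CondDistrib

variable {Ω β S E : Type*} {mΩ : MeasurableSpace Ω} {mβ : MeasurableSpace β} {μ : Measure Ω}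
  [IsProbabilityMeasure μ] {X : Ω → β}
  [MeasurableSpace S] [StandardBorelSpace S] [Nonempty S]
  [MeasurableSpace E] [StandardBorelSpace E]

/-- Disintegration of the joint law of `(X, W)`. The integrand may depend on `X` too, which is
needed because the centring by conditional means is a function of `X`. -/
theorem condLExp_prod_ae_eq_lintegral_condDistrib (hX : Measurable X) {W : Ω → S}
    (hW : Measurable W) {h : β × S → ℝ≥0∞} (hh : Measurable h) :
    μ⁻[fun ω ↦ h (X ω, W ω)|mβ.comap X]
      =ᵐ[μ] fun ω ↦ ∫⁻ s, h (X ω, s) ∂condDistrib W X μ (X ω) := by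
  have hm : Measurable fun b ↦ ∫⁻ s, h (b, s) ∂condDistrib W X μ b :=
    hh.lintegral_kernel_prod_right'
  refine (ae_eq_condLExp hX.comap_le μ _ (hm.comp (comap_measurable X)) ?_).symm
  rintro _ ⟨t, ht, rfl⟩
  have h1 := setLIntegral_map ht hm hX (μ := μ)
  have h2 := Measure.setLIntegral_compProd (μ := μ.map X) (κ := condDistrib W X μ) hh ht
    MeasurableSet.univ
  rw [compProd_map_condDistrib hW.aemeasurable,
    setLIntegral_map (ht.prod MeasurableSet.univ) hh (hX.prodMk hW), Set.mk_preimage_prod,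
    Set.preimage_univ, Set.inter_univ] at h2
  simp only [Measure.restrict_univ] at h2
  rw [h2]
  exact h1.symm

theorem condLExp_ae_eq_lintegral_condDistrib (hX : Measurable X) {W : Ω → S}
    (hW : Measurable W) {h : S → ℝ≥0∞} (hh : Measurable h) :
    μ⁻[fun ω ↦ h (W ω)|mβ.comap X]
      =ᵐ[μ] fun ω ↦ ∫⁻ s, h s ∂condDistrib W X μ (X ω) :=
  condLExp_prod_ae_eq_lintegral_condDistrib hX hW (hh.comp measurable_snd)

variable (E) in
-- Countability merges the exceptional null sets of the individual events into one; the π-system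
-- property then determines the measures. Membership of `univ` provides the spanning sets required
-- for a product measure.
theorem exists_countable_generating_isPiSystem : ∃ 𝒜 : Set (Set E), 𝒜.Countable ∧
    (∀ s ∈ 𝒜, MeasurableSet s) ∧ MeasurableSpace.generateFrom 𝒜 = ‹MeasurableSpace E› ∧
    IsPiSystem 𝒜 ∧ Set.univ ∈ 𝒜 := by
  have hgen : MeasurableSpace.generateFrom (generateSetAlgebra
      (MeasurableSpace.countableGeneratingSet E)) = ‹MeasurableSpace E› := by
    rw [generateFrom_generateSetAlgebra_eq, MeasurableSpace.generateFrom_countableGeneratingSet]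
  have halg := isSetAlgebra_generateSetAlgebra (𝒜 := MeasurableSpace.countableGeneratingSet E)
  refine ⟨_, countable_generateSetAlgebra MeasurableSpace.countable_countableGeneratingSet,
    fun s hs ↦ ?_, hgen, fun s hs t ht _ ↦ halg.inter_mem hs ht, halg.univ_mem⟩
  rw [← hgen]
  exact MeasurableSpace.measurableSet_generateFrom hs

variable [Nonempty E]

/-- The conditional distribution of a conditionally independent family is a product measure. -/
theorem CondIndepGiven.condDistrib_ae_eq_pi {ι : Type*} [Fintype ι] (hX : Measurable X)
    {Z : ι → Ω → E} (hZ : ∀ k, Measurable (Z k)) (h : CondIndepGiven (mβ.comap X) μ Z) :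
    ∀ᵐ ω ∂μ, condDistrib (fun ω k ↦ Z k ω) X μ (X ω)
      = Measure.pi fun k ↦ condDistrib (Z k) X μ (X ω) := by
  obtain ⟨𝒜, hcount, hmeas, hgen, hpi, huniv⟩ := exists_countable_generating_isPiSystem E
  have hW : Measurable fun ω k ↦ Z k ω := measurable_pi_lambda _ hZ
  have : Countable 𝒜 := hcount
  -- Each box has its own null set; there are countably many boxes because `ι` is finite.
  have hbox : ∀ s : ι → 𝒜, ∀ᵐ ω ∂μ,
      (condDistrib (fun ω k ↦ Z k ω) X μ (X ω)).real (Set.pi Set.univ fun k ↦ (s k : Set E))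
        = ∏ k, (condDistrib (Z k) X μ (X ω)).real (s k) := by
    intro s
    have hs : ∀ k, MeasurableSet (s k : Set E) := fun k ↦ hmeas _ (s k).2
    have h1 := condDistrib_ae_eq_condExp (μ := μ) hX hW (MeasurableSet.univ_pi hs)
    have h2 := h Finset.univ (fun k ↦ s k) fun k _ ↦ hs k
    have h3 : ∀ᵐ ω ∂μ, ∀ k, (condDistrib (Z k) X μ (X ω)).real (s k)
        = (μ⟦Z k ⁻¹' s k|mβ.comap X⟧) ω :=
      ae_all_iff.mpr fun k ↦ condDistrib_ae_eq_condExp hX (hZ k) (hs k)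
    have hset : (fun ω k ↦ Z k ω) ⁻¹' (Set.pi Set.univ fun k ↦ (s k : Set E))
        = ⋂ k ∈ Finset.univ, Z k ⁻¹' (s k : Set E) := by
      ext ω
      simp
    rw [hset] at h1
    filter_upwards [h1, h2, h3] with ω h1 h2 h3
    rw [h1, h2, Finset.prod_apply]
    exact Finset.prod_congr rfl fun k _ ↦ (h3 k).symm
  filter_upwards [ae_all_iff.mpr hbox] with ω hω
  refine (Measure.pi_eq_generateFrom (C := fun _ ↦ 𝒜) (fun _ ↦ hgen) (fun _ ↦ hpi)
    (fun k ↦ ⟨fun _ ↦ Set.univ, fun _ ↦ huniv, fun _ ↦ measure_lt_top _ _, Set.iUnion_const _⟩)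
    fun s hs ↦ ?_).symm
  have h1 := hω fun k ↦ ⟨s k, hs k⟩
  simp only [measureReal_def, ← ENNReal.toReal_prod] at h1
  rwa [ENNReal.toReal_eq_toReal_iff' (measure_ne_top _ _)
    (ENNReal.prod_ne_top fun k _ ↦ measure_ne_top _ _)] at h1

theorem SameCondLaw.condDistrib_ae_eq (hX : Measurable X) {Z Z' : Ω → E} (hZ : Measurable Z)
    (hZ' : Measurable Z') (h : SameCondLaw (mβ.comap X) μ Z Z') :
    ∀ᵐ ω ∂μ, condDistrib Z X μ (X ω) = condDistrib Z' X μ (X ω) := by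
  obtain ⟨𝒜, hcount, hmeas, hgen, hpi, -⟩ := exists_countable_generating_isPiSystem E
  have : Countable 𝒜 := hcount
  have hset : ∀ s : 𝒜, ∀ᵐ ω ∂μ,
      (condDistrib Z X μ (X ω)).real s = (condDistrib Z' X μ (X ω)).real s := by
    intro s
    filter_upwards [condDistrib_ae_eq_condExp (μ := μ) hX hZ (hmeas s s.2),
      condDistrib_ae_eq_condExp (μ := μ) hX hZ' (hmeas s s.2), h s (hmeas s s.2)] with ω h1 h2 h3
    rw [h1, h2, h3]
  filter_upwards [ae_all_iff.mpr hset] with ω hω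
  refine ext_of_generate_finite 𝒜 hgen.symm hpi (fun s hs ↦ ?_) (by simp)
  exact (measureReal_eq_measureReal_iff (measure_ne_top _ _) (measure_ne_top _ _)).mp (hω ⟨s, hs⟩)

/-- The generalised conditional expectation is the integral against the conditional
distribution. -/
theorem cExp_ae_eq_integral_condDistrib (hX : Measurable X) {W : Ω → S} (hW : Measurable W)
    {f : S → ℝ} (hf : Measurable f)
    (hfin : ∀ᵐ ω ∂μ, (μ⁻[fun x ↦ ‖f (W x)‖ₑ|mβ.comap X]) ω < ∞) :
    ∀ᵐ ω ∂μ, Integrable f (condDistrib W X μ (X ω)) ∧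
      cExp (mβ.comap X) μ (fun ω ↦ f (W ω)) ω = ∫ s, f s ∂condDistrib W X μ (X ω) := by
  filter_upwards [hfin, condLExp_ae_eq_lintegral_condDistrib (μ := μ) hX hW hf.enorm,
    condLExp_ae_eq_lintegral_condDistrib (μ := μ) hX hW hf.ennreal_ofReal,
    condLExp_ae_eq_lintegral_condDistrib (μ := μ) hX hW hf.neg.ennreal_ofReal] with ω h0 h1 h2 h3
  have hint : Integrable f (condDistrib W X μ (X ω)) :=
    ⟨hf.aestronglyMeasurable, by rw [HasFiniteIntegral, ← h1]; exact h0⟩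
  refine ⟨hint, ?_⟩
  rw [integral_eq_lintegral_pos_part_sub_lintegral_neg_part hint, cExp, h2]
  congr 2

end CondDistrib

/-! ### The conditional inequality for fixed `n`. -/

section FixedSize

variable {Ω β E : Type*} {mΩ : MeasurableSpace Ω} {mβ : MeasurableSpace β} {μ : Measure Ω}
  [IsProbabilityMeasure μ] {X : Ω → β} [MeasurableSpace E] [StandardBorelSpace E] [Nonempty E]
  {n : ℕ} {e e' : Fin n → Ω → E} {F : Fin n → (Fin n → E) → ℝ} {p : ℝ}

/-- The functional dependence measure in terms of the conditional distributions. -/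
theorem fdm_ae_eq (hX : Measurable X) (he : ∀ i, Measurable (e i))
    (he' : ∀ i, Measurable (e' i)) {i : Fin n}
    (hindep : CondIndepGiven (mβ.comap X) μ (fun k : Option (Fin n) ↦ k.elim (e' i) e))
    (hlaw : SameCondLaw (mβ.comap X) μ (e' i) (e i)) (hF : ∀ j, Measurable (F j)) (j : Fin n) :
    ∀ᵐ ω ∂μ, fdm (mβ.comap X) μ p F e e' j i ω
      = (∫⁻ y, ∫⁻ x, ‖F j x - F j (Function.update x i y)‖ₑ ^ p
          ∂Measure.pi (fun k ↦ condDistrib (e k) X μ (X ω)) ∂condDistrib (e i) X μ (X ω))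
          ^ (1 / p) := by
  -- The copy `e' i` becomes coordinate 0 and the original vectors the tail, so the joint
  -- conditional law is a product over `Fin (n + 1)` and its first factor splits off.
  set Z : Fin (n + 1) → Ω → E := fun k ↦ (finSuccEquiv n k).elim (e' i) e with hZdef
  have hZ0 : Z 0 = e' i := by simp [hZdef]
  have hZs : ∀ k : Fin n, Z k.succ = e k := fun k ↦ by simp [hZdef]
  have hZ : ∀ k, Measurable (Z k) := Fin.cases (hZ0 ▸ he' i) fun k ↦ hZs k ▸ he k
  have hZind : CondIndepGiven (mβ.comap X) μ Z := hindep.comp_injective (finSuccEquiv n).injective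
  have hW : Measurable fun ω k ↦ Z k ω := measurable_pi_lambda _ hZ
  set D : (Fin (n + 1) → E) → ℝ≥0∞ :=
    fun z ↦ ‖F j (Fin.tail z) - F j (Function.update (Fin.tail z) i (z 0))‖ₑ ^ p with hD
  have htail : Measurable (Fin.tail : (Fin (n + 1) → E) → Fin n → E) :=
    measurable_pi_lambda _ fun k ↦ measurable_pi_apply k.succ
  have hupd : Measurable fun z : Fin (n + 1) → E ↦ Function.update (Fin.tail z) i (z 0) :=
    measurable_pi_lambda _ fun k ↦ by
      rcases eq_or_ne k i with rfl | hk
      · simpa using measurable_pi_apply 0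
      · simpa [hk, Function.comp_def] using (measurable_pi_apply k).comp htail
  have hDm : Measurable D := (((hF j).comp htail).sub ((hF j).comp hupd)).enorm.pow_const p
  have hDW : (fun ω ↦ ‖outcome F e j ω - coupledOutcome F e e' j i ω‖ₑ ^ p)
      = fun ω ↦ D fun k ↦ Z k ω := by
    funext ω
    have : Fin.tail (fun k ↦ Z k ω) = fun k ↦ e k ω := funext fun k ↦ congrFun (hZs k) ω
    simp only [hD, this, hZ0, outcome, coupledOutcome]
  filter_upwards [condLExp_ae_eq_lintegral_condDistrib (μ := μ) hX hW hDm,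
    hZind.condDistrib_ae_eq_pi hX hZ, hlaw.condDistrib_ae_eq hX (he' i) (he i)] with ω h1 h2 h3
  rw [fdm, cLpNorm, hDW, h1, h2, ← (measurePreserving_cons fun k ↦
    condDistrib (Z k) X μ (X ω)).lintegral_comp_emb measurableEmbedding_cons]
  have h4 := hDm.comp (measurableEmbedding_cons (E := E) (n := n)).measurable
  simp only [Function.comp_def] at h4
  rw [lintegral_prod _ h4.aemeasurable]
  simp only [hZ0, hZs, h3, hD, Fin.tail_cons, Fin.cons_zero]

theorem avgNorm_ae_le (hn : 1 ≤ n) (hp : 1 < p) (hX : Measurable X) (he : ∀ i, Measurable (e i))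
    (he' : ∀ i, Measurable (e' i))
    (hindep : ∀ i, CondIndepGiven (mβ.comap X) μ (fun k : Option (Fin n) ↦ k.elim (e' i) e))
    (hlaw : ∀ i, SameCondLaw (mβ.comap X) μ (e' i) (e i)) (hF : ∀ j, Measurable (F j))
    (hY : ∀ j, ∀ᵐ ω ∂μ, (μ⁻[fun x ↦ ‖outcome F e j x‖ₑ|mβ.comap X]) ω < ∞) :
    ∀ᵐ ω ∂μ, avgNorm (mβ.comap X) μ p F e ω ≤ ENNReal.ofReal (Cconst p)
      * Delta (mβ.comap X) μ p (min p 2) F e e' ω ^ (1 / min p 2) := by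
  have hp0 : 0 < p := by linarith
  have hq : 0 < min p 2 := lt_min hp0 two_pos
  have hW : Measurable fun ω k ↦ e k ω := measurable_pi_lambda _ he
  have heind : CondIndepGiven (mβ.comap X) μ e :=
    (hindep ⟨0, hn⟩).comp_injective (g := some) (Option.some_injective _)
  -- The conditional means are written as measurable functions of `X`, so that the centred sum is a
  -- measurable function of `X` and the vectors.
  set m : Fin n → β → ℝ := fun j b ↦ ∫ x, F j x ∂condDistrib (fun ω k ↦ e k ω) X μ b with hm
  have hmm : ∀ j, Measurable (m j) := fun j ↦ by
    have hj : StronglyMeasurable fun z : β × (Fin n → E) ↦ F j z.2 :=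
      ((hF j).comp measurable_snd).stronglyMeasurable
    exact (hj.integral_condDistrib (μ := μ) (Y := fun ω k ↦ e k ω) (X := X)).measurable
  have hcExp : ∀ᵐ ω ∂μ, ∀ j, Integrable (F j) (condDistrib (fun ω k ↦ e k ω) X μ (X ω)) ∧
      cExp (mβ.comap X) μ (outcome F e j) ω = m j (X ω) :=
    ae_all_iff.mpr fun j ↦ cExp_ae_eq_integral_condDistrib hX hW (hF j) (hY j)
  have hfdm : ∀ᵐ ω ∂μ, ∀ i j, fdm (mβ.comap X) μ p F e e' j i ω
      = (∫⁻ y, ∫⁻ x, ‖F j x - F j (Function.update x i y)‖ₑ ^ p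
          ∂Measure.pi (fun k ↦ condDistrib (e k) X μ (X ω)) ∂condDistrib (e i) X μ (X ω))
          ^ (1 / p) :=
    ae_all_iff.mpr fun i ↦ ae_all_iff.mpr fun j ↦
      fdm_ae_eq hX he he' (hindep i) (hlaw i) hF j
  have hh : Measurable fun z : β × (Fin n → E) ↦ ‖∑ j, (F j z.2 - m j z.1)‖ₑ ^ p :=
    (Finset.measurable_fun_sum _ fun j _ ↦ ((hF j).comp measurable_snd).sub
      ((hmm j).comp measurable_fst)).enorm.pow_const p
  have hcongr : (fun x ↦ ‖∑ j, (outcome F e j x - cExp (mβ.comap X) μ (outcome F e j) x)‖ₑ ^ p)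
      =ᵐ[μ] fun x ↦ ‖∑ j, (F j (fun k ↦ e k x) - m j (X x))‖ₑ ^ p := by
    filter_upwards [hcExp] with ω hω
    simp only [outcome, (hω _).2]
  filter_upwards [condLExp_congr_ae (mΩ := mβ.comap X) hcongr,
    condLExp_prod_ae_eq_lintegral_condDistrib (μ := μ) hX hW hh, hcExp, hfdm,
    heind.condDistrib_ae_eq_pi hX he] with ω h1 h2 h3 h4 h5
  have hint : ∀ j, Integrable (F j) (Measure.pi fun k ↦ condDistrib (e k) X μ (X ω)) := fun j ↦
    h5 ▸ (h3 j).1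
  have hfinal := lintegral_pi_sum_sub_integral_rpow_le hp _ hF hint
  rw [avgNorm, cLpNorm, h1, h2, Delta, ENNReal.mul_rpow_of_nonneg _ _ (by positivity)]
  simp only [hm, h5, h4]
  -- The normalisation `n^(-q)` in `Delta` becomes `1/n` after the `q`-th root, matching the average
  -- on the left.
  have hn' : (1 / (n : ℝ≥0∞) ^ min p 2) ^ (1 / min p 2) = 1 / n := by
    rw [one_div, one_div, ENNReal.inv_rpow, ← ENNReal.rpow_mul, mul_inv_cancel₀ hq.ne',
      ENNReal.rpow_one, one_div]
  rw [hn', mul_left_comm]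
  gcongr

end FixedSize

end NetworkFDM

/-- Any sub-σ-field is generated by the identity map into `(Ω, C)`. Conditional laws are taken only
of variables valued in powers of `E`, so no standard Borel assumption on `Ω` is needed. -/
theorem NetworkFDM.avgNorm_ae_le_of_le {Ω E : Type*} {C : MeasurableSpace Ω}
    {mΩ : MeasurableSpace Ω} (hC : C ≤ mΩ) {μ : Measure Ω} [IsProbabilityMeasure μ]
    [MeasurableSpace E] [StandardBorelSpace E] [Nonempty E] {n : ℕ} {e e' : Fin n → Ω → E}
    {F : Fin n → (Fin n → E) → ℝ} {p : ℝ} (hn : 1 ≤ n) (hp : 1 < p)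
    (he : ∀ i, Measurable (e i)) (he' : ∀ i, Measurable (e' i))
    (hindep : ∀ i, CondIndepGiven C μ (fun k : Option (Fin n) ↦ k.elim (e' i) e))
    (hlaw : ∀ i, SameCondLaw C μ (e' i) (e i)) (hF : ∀ j, Measurable (F j))
    (hY : ∀ j, ∀ᵐ ω ∂μ, (μ⁻[fun x ↦ ‖outcome F e j x‖ₑ|C]) ω < ∞) :
    ∀ᵐ ω ∂μ, avgNorm C μ p F e ω ≤ ENNReal.ofReal (Cconst p)
      * Delta C μ p (min p 2) F e e' ω ^ (1 / min p 2) := by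
  have hX : @Measurable Ω Ω mΩ C id := measurable_id'' hC
  have h := @avgNorm_ae_le Ω Ω E mΩ C μ _ id _ _ _ n e e' F p hn hp hX he he'
  rw [MeasurableSpace.comap_id] at h
  exact h hindep hlaw hF hY

theorem mainTheorem2 {Ω : Type*} [mΩ : MeasurableSpace Ω] (μ : Measure Ω) [IsProbabilityMeasure μ]
    (d : ℕ) (C : ℕ → MeasurableSpace Ω) (hC : ∀ n, C n ≤ mΩ)
    -- the innovations `e n i` and the copies `e' n i` of them
    (e e' : (n : ℕ) → Fin n → Ω → EuclideanSpace ℝ (Fin d))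
    (he : ∀ n i, Measurable (e n i)) (he' : ∀ n i, Measurable (e' n i))
    -- for each `i`, the vectors `e' n i, e n 1, …, e n n` are conditionally independent given `C n`
    (hindep : ∀ n (i : Fin n),
      NetworkFDM.CondIndepGiven (C n) μ (fun k : Option (Fin n) ↦ k.elim (e' n i) (e n)))
    (hlaw : ∀ n i, NetworkFDM.SameCondLaw (C n) μ (e' n i) (e n i))
    (F : (n : ℕ) → Fin n → (Fin n → EuclideanSpace ℝ (Fin d)) → ℝ)
    (hF : ∀ n j, Measurable (F n j))
    -- the conditional expectations of the outcomes exist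
    (hY : ∀ n j, ∀ᵐ ω ∂μ, (μ⁻[fun x ↦ ‖NetworkFDM.outcome (F n) (e n) j x‖ₑ|C n]) ω < ∞)
    (p : ℝ) (hp : 1 < p) :
    (∀ n : ℕ, 1 ≤ n → ∀ᵐ ω ∂μ,
      NetworkFDM.avgNorm (C n) μ p (F n) (e n) ω
        ≤ ENNReal.ofReal (NetworkFDM.Cconst p)
          * NetworkFDM.Delta (C n) μ p (min p 2) (F n) (e n) (e' n) ω ^ (1 / min p 2)) ∧
    ((∀ᵐ ω ∂μ, Tendsto
        (fun n ↦ NetworkFDM.Delta (C n) μ p (min p 2) (F n) (e n) (e' n) ω) atTop (𝓝 0)) →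
      ∀ᵐ ω ∂μ, Tendsto (fun n ↦ NetworkFDM.avgNorm (C n) μ p (F n) (e n) ω) atTop (𝓝 0)) := by
  have hbound : ∀ n : ℕ, 1 ≤ n → ∀ᵐ ω ∂μ, NetworkFDM.avgNorm (C n) μ p (F n) (e n) ω
      ≤ ENNReal.ofReal (NetworkFDM.Cconst p)
        * NetworkFDM.Delta (C n) μ p (min p 2) (F n) (e n) (e' n) ω ^ (1 / min p 2) :=
    fun n hn ↦ NetworkFDM.avgNorm_ae_le_of_le (hC n) hn hp (he n) (he' n) (hindep n) (hlaw n)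
      (hF n) (hY n)
  refine ⟨hbound, fun hlim ↦ ?_⟩
  have hq : 0 < 1 / min p 2 := one_div_pos.mpr (lt_min (by linarith) two_pos)
  -- One null set serves all `n ≥ 1`, so on its complement the limit is a pointwise squeeze;
  -- finiteness of the constant rules out `∞ · 0`.
  filter_upwards [hlim, ae_all_iff.mpr fun n ↦ ae_all_iff.mpr (hbound n)] with ω hω hb
  have h1 := ENNReal.Tendsto.const_mul (hω.ennrpow_const (1 / min p 2))
    (Or.inr (ENNReal.ofReal_ne_top (r := NetworkFDM.Cconst p)))
  rw [ENNReal.zero_rpow_of_pos hq, mul_zero] at h1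
  refine tendsto_of_tendsto_of_tendsto_of_le_of_le' tendsto_const_nhds h1
    (Eventually.of_forall fun n ↦ zero_le) ?_
  filter_upwards [eventually_ge_atTop 1] with n hn using hb n hn
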